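/- Let $n\ge 2$, $m\ge 1$ be integers and $1\le a<b<n$. Let $\psi:(a,b)\to(0,\infty)$ be continuous and bounded away from zero (in particular $\psi$ may be any positive continuous log-convex function on $(a,b)$, or any continuous positive function of the form $\psi(p)=|f|_p$, $p\in(a,b)$). For a measure $\mu$, the grand Lebesgue space $G(\psi)=G(\psi;a,b)$ consists of the (classes of) measurable real functions with $$\|h\|_{G(\psi;a,b)}=\sup_{p\in(a,b)}\frac{|h|_p}{\psi(p)}<\infty,\qquad |h|_p=\Big(\int|h|^p\,d\mu\Big)^{1/p}.$$ Let $X\subseteq\mathbb R^n$ be a convex domain (open and convex; no regularity of the boundary is needed), with Lebesgue measure, and let $Y\subseteq X$ be an $m$-dimensional convex subset (its affine hull has dimension $m$), with the $m$-dimensional surface measure. Put $$A_2=\max\Big(1,\frac{am}{n-a}\Big),\qquad B_2=\frac{bm}{n-b},\qquad \nu(q)=q^{1-1/n}\,\psi\Big(\frac{qn}{q+m}\Big)\quad (A_2<q<B_2),$$ and assume $A_2<B_2$. Let $W_1(\psi)$ be the space of the continuously differentiable functions $u$ on $X$ with $u(x)\to0$ as $|x|\to\infty$ and with finite norm $$\|u\|_{W_1(\psi)}=\|\,|\mathrm{grad}\,u|\,\|_{G(\psi;a,b)}+\|u\|_{G(\psi;a,b)}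 ,$$ and let $Bu=u|_Y$. Then the Sobolev embedding operator $S: W_1(\psi)\to G(\nu;A_2,B_2)$, $Su=Bu$, is not compact. More precisely, $S$, considered on its natural domain $\{u\in W_1(\psi): Bu\in G(\nu;A_2,B_2)\}$ with the norm of $W_1(\psi)$ (this is all of $W_1(\psi)$ whenever the Sobolev inequality $\|Bu\|_{G(\nu)}\le C\,\|\,|\mathrm{grad}\,u|\,\|_{G(\psi)}$ holds), is not a compact operator. -/

import Mathlib

open MeasureTheory Set Filter Topology
open scoped ENNReal

noncomputable section

/-- A weight `ψ : (a, b) → (0, ∞)` on a bounded interval of exponents, `1 ≤ a < b < ∞`: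
continuous, positive and bounded away from zero. -/
structure GrandWeight where
  a : ℝ
  b : ℝ
  one_le_a : 1 ≤ a
  a_lt_b : a < b
  toFun : ℝ → ℝ
  continuousOn : ContinuousOn toFun (Ioo a b)
  exists_pos_le : ∃ c : ℝ, 0 < c ∧ ∀ p ∈ Ioo a b, c ≤ toFun p

namespace GrandWeight

theorem pos (ψ : GrandWeight) {p : ℝ} (hp : p ∈ Ioo ψ.a ψ.b) : 0 < ψ.toFun p := by
  obtain ⟨c, hc, h⟩ := ψ.exists_pos_le
  exact hc.trans_le (h p hp)

/-- The extended norm `‖f‖_{G(ψ)} = sup_{p ∈ (a,b)} |f|_p / ψ(p)`, with values in `[0, ∞]`. -/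
def eNorm {α : Type*} [MeasurableSpace α] (ψ : GrandWeight) (f : α → ℝ) (μ : Measure α) : ℝ≥0∞ :=
  ⨆ p ∈ Ioo ψ.a ψ.b, eLpNorm f (ENNReal.ofReal p) μ / ENNReal.ofReal (ψ.toFun p)

section eNorm

variable {α : Type*} [MeasurableSpace α] (ψ : GrandWeight) {μ : Measure α}

theorem eNorm_congr {f g : α → ℝ} (h : f =ᵐ[μ] g) : ψ.eNorm f μ = ψ.eNorm g μ := by
  simp only [eNorm, eLpNorm_congr_ae h]

theorem eNorm_mono {f g : α → ℝ} (h : ∀ᵐ x ∂μ, ‖f x‖ ≤ ‖g x‖) :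
    ψ.eNorm f μ ≤ ψ.eNorm g μ :=
  iSup₂_mono fun _ _ => ENNReal.div_le_div_right (eLpNorm_mono_ae h) _

theorem eNorm_zero : ψ.eNorm (0 : α → ℝ) μ = 0 := by
  simp [eNorm]

theorem eNorm_add_le {f g : α → ℝ} (hf : AEStronglyMeasurable f μ)
    (hg : AEStronglyMeasurable g μ) : ψ.eNorm (f + g) μ ≤ ψ.eNorm f μ + ψ.eNorm g μ := by
  refine iSup₂_le fun p hp => ?_
  have h1 : (1 : ℝ≥0∞) ≤ ENNReal.ofReal p := by
    rw [← ENNReal.ofReal_one]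
    exact ENNReal.ofReal_le_ofReal (ψ.one_le_a.trans hp.1.le)
  refine (ENNReal.div_le_div_right (eLpNorm_add_le hf hg h1) _).trans ?_
  rw [ENNReal.add_div]
  exact add_le_add
    (le_iSup₂ (f := fun p (_ : p ∈ Ioo ψ.a ψ.b) =>
      eLpNorm f (ENNReal.ofReal p) μ / ENNReal.ofReal (ψ.toFun p)) p hp)
    (le_iSup₂ (f := fun p (_ : p ∈ Ioo ψ.a ψ.b) =>
      eLpNorm g (ENNReal.ofReal p) μ / ENNReal.ofReal (ψ.toFun p)) p hp)

theorem eNorm_const_smul (c : ℝ) (f : α → ℝ) : ψ.eNorm (c • f) μ = ‖c‖ₑ * ψ.eNorm f μ := by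
  simp only [eNorm, eLpNorm_const_smul, mul_div_assoc, ENNReal.mul_iSup]

theorem ae_eq_zero_of_eNorm_eq_zero {f : α → ℝ} (hf : AEStronglyMeasurable f μ)
    (h : ψ.eNorm f μ = 0) : f =ᵐ[μ] 0 := by
  obtain ⟨p, hp⟩ := nonempty_Ioo.2 ψ.a_lt_b
  have h0 : eLpNorm f (ENNReal.ofReal p) μ / ENNReal.ofReal (ψ.toFun p) = 0 :=
    le_antisymm (h ▸ le_iSup₂ (f := fun p (_ : p ∈ Ioo ψ.a ψ.b) =>
      eLpNorm f (ENNReal.ofReal p) μ / ENNReal.ofReal (ψ.toFun p)) p hp) zero_le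
  have hp0 : ENNReal.ofReal p ≠ 0 := by
    have : 0 < p := zero_lt_one.trans_le (ψ.one_le_a.trans hp.1.le)
    simpa using this
  rw [ENNReal.div_eq_zero_iff] at h0
  exact (eLpNorm_eq_zero_iff hf hp0).1 (h0.resolve_right ENNReal.ofReal_ne_top)

end eNorm

/-- `A₂ = max(1, a m / (n - a))`. -/
def A₂ (ψ : GrandWeight) (n m : ℕ) : ℝ := max 1 (ψ.a * m / (n - ψ.a))

/-- `B₂ = b m / (n - b)`. -/
def B₂ (ψ : GrandWeight) (n m : ℕ) : ℝ := ψ.b * m / (n - ψ.b)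

/-- For `A₂ < q < B₂` the exponent `q n / (q + m)` lies in `(a, b)`. -/
theorem exponent_mem (ψ : GrandWeight) {n m : ℕ} (hb : ψ.b < n) {q : ℝ}
    (hq : q ∈ Ioo (ψ.A₂ n m) (ψ.B₂ n m)) : q * n / (q + m) ∈ Ioo ψ.a ψ.b := by
  have hq1 : 1 < q := (le_max_left _ _).trans_lt hq.1
  have h1 : ψ.a * m / (n - ψ.a) < q := (le_max_right _ _).trans_lt hq.1
  have h2 : q < ψ.b * m / (n - ψ.b) := hq.2
  have hm : (0 : ℝ) ≤ m := Nat.cast_nonneg m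
  have ha := ψ.a_lt_b
  rw [div_lt_iff₀ (by linarith)] at h1
  rw [lt_div_iff₀ (by linarith)] at h2
  constructor
  · rw [lt_div_iff₀ (by linarith)]; linarith
  · rw [div_lt_iff₀ (by linarith)]; linarith

/-- The weight `ν(q) = q^{1 - 1/n} ψ(q n / (q + m))`, `q ∈ (A₂, B₂)`. -/
def trace (ψ : GrandWeight) (n m : ℕ) (hb : ψ.b < n) (hAB : ψ.A₂ n m < ψ.B₂ n m) :
    GrandWeight where
  a := ψ.A₂ n m
  b := ψ.B₂ n m
  one_le_a := le_max_left _ _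
  a_lt_b := hAB
  toFun q := q ^ (1 - 1 / (n : ℝ)) * ψ.toFun (q * n / (q + m))
  continuousOn := by
    have hpos : ∀ q ∈ Ioo (ψ.A₂ n m) (ψ.B₂ n m), (1 : ℝ) < q := fun q hq =>
      (le_max_left _ _).trans_lt hq.1
    have hm : (0 : ℝ) ≤ m := Nat.cast_nonneg m
    refine ContinuousOn.mul ?_ (ψ.continuousOn.comp ?_ fun q hq => ψ.exponent_mem hb hq)
    · exact continuousOn_id.rpow_const fun q hq => Or.inl (zero_lt_one.trans (hpos q hq)).ne'
    · exact ContinuousOn.div (by fun_prop) (by fun_prop) fun q hq => by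
        have := hpos q hq
        positivity
  exists_pos_le := by
    obtain ⟨c, hc, h⟩ := ψ.exists_pos_le
    refine ⟨c, hc, fun q hq => ?_⟩
    have hq1 : 1 < q := (le_max_left _ _).trans_lt hq.1
    have hn : (1 : ℝ) ≤ n := ψ.one_le_a.trans (ψ.a_lt_b.le.trans hb.le)
    have he : 0 ≤ 1 - 1 / (n : ℝ) := by
      rw [sub_nonneg, div_le_one (by linarith)]
      exact hn
    have h1 : 1 ≤ q ^ (1 - 1 / (n : ℝ)) := Real.one_le_rpow hq1.le he
    have h2 := h _ (ψ.exponent_mem hb hq)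
    nlinarith

end GrandWeight

/-! ### The grand Lebesgue space -/

/-- Classes of measurable functions with finite `G(ψ)` norm, as a subspace of `L⁰(μ)`. -/
def grandSubmodule {α : Type*} [MeasurableSpace α] (ψ : GrandWeight) (μ : Measure α) :
    Submodule ℝ (α →ₘ[μ] ℝ) where
  carrier := {f | ψ.eNorm f μ < ∞}
  zero_mem' := by
    change ψ.eNorm ((0 : α →ₘ[μ] ℝ) : α → ℝ) μ < ∞
    rw [ψ.eNorm_congr AEEqFun.coeFn_zero, ψ.eNorm_zero]
    exact ENNReal.zero_lt_top
  add_mem' {f g} hf hg := by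
    change ψ.eNorm ((f + g : α →ₘ[μ] ℝ) : α → ℝ) μ < ∞
    rw [ψ.eNorm_congr (AEEqFun.coeFn_add f g)]
    exact (ψ.eNorm_add_le f.aestronglyMeasurable g.aestronglyMeasurable).trans_lt
      (ENNReal.add_lt_top.2 ⟨hf, hg⟩)
  smul_mem' c f hf := by
    change ψ.eNorm ((c • f : α →ₘ[μ] ℝ) : α → ℝ) μ < ∞
    rw [ψ.eNorm_congr (AEEqFun.coeFn_smul c f), ψ.eNorm_const_smul]
    exact ENNReal.mul_lt_top (by simp) hf

/-- The grand Lebesgue space `G(ψ) = G(ψ; a, b)` over the measure `μ`. -/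
def GrandLebesgue {α : Type*} [MeasurableSpace α] (ψ : GrandWeight) (μ : Measure α) : Type _ :=
  grandSubmodule ψ μ

namespace GrandLebesgue

variable {α : Type*} [MeasurableSpace α] {ψ : GrandWeight} {μ : Measure α}

instance : AddCommGroup (GrandLebesgue ψ μ) := inferInstanceAs (AddCommGroup (grandSubmodule ψ μ))

instance : Module ℝ (GrandLebesgue ψ μ) := inferInstanceAs (Module ℝ (grandSubmodule ψ μ))

/-- `‖f‖_{G(ψ)} = sup_{p ∈ (a,b)} |f|_p / ψ(p)`, which is finite on `G(ψ)`. -/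
instance : Norm (GrandLebesgue ψ μ) := ⟨fun f => (ψ.eNorm f.1 μ).toReal⟩

theorem normedSpaceCore : NormedSpace.Core ℝ (GrandLebesgue ψ μ) where
  norm_nonneg _ := ENNReal.toReal_nonneg
  norm_smul c f := by
    change (ψ.eNorm ((c • f.1 : α →ₘ[μ] ℝ) : α → ℝ) μ).toReal = ‖c‖ * (ψ.eNorm f.1 μ).toReal
    rw [ψ.eNorm_congr (AEEqFun.coeFn_smul c f.1), ψ.eNorm_const_smul, ENNReal.toReal_mul,
      toReal_enorm]
  norm_triangle f g := by
    change (ψ.eNorm ((f.1 + g.1 : α →ₘ[μ] ℝ) : α → ℝ) μ).toReal ≤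
      (ψ.eNorm f.1 μ).toReal + (ψ.eNorm g.1 μ).toReal
    rw [ψ.eNorm_congr (AEEqFun.coeFn_add f.1 g.1), ← ENNReal.toReal_add f.2.ne g.2.ne]
    exact ENNReal.toReal_mono (ENNReal.add_lt_top.2 ⟨f.2, g.2⟩).ne
      (ψ.eNorm_add_le f.1.aestronglyMeasurable g.1.aestronglyMeasurable)
  norm_eq_zero_iff f := by
    constructor
    · intro h
      have h0 : ψ.eNorm f.1 μ = 0 :=
        ((ENNReal.toReal_eq_zero_iff _).1 h).resolve_right f.2.ne
      have h1 := ψ.ae_eq_zero_of_eNorm_eq_zero f.1.aestronglyMeasurable h0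
      exact Subtype.ext (AEEqFun.ext (h1.trans AEEqFun.coeFn_zero.symm))
    · rintro rfl
      change (ψ.eNorm ((0 : α →ₘ[μ] ℝ) : α → ℝ) μ).toReal = 0
      rw [ψ.eNorm_congr AEEqFun.coeFn_zero, ψ.eNorm_zero, ENNReal.toReal_zero]

instance : NormedAddCommGroup (GrandLebesgue ψ μ) := NormedAddCommGroup.ofCore normedSpaceCore

instance : NormedSpace ℝ (GrandLebesgue ψ μ) := NormedSpace.ofCore normedSpaceCore

end GrandLebesgue

/-! ### The Sobolev grand Lebesgue space -/

section Sobolev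

variable {n : ℕ}

theorem continuousOn_gradient {X : TopologicalSpace.Opens (EuclideanSpace ℝ (Fin n))}
    {u : EuclideanSpace ℝ (Fin n) → ℝ} (hu : ContDiffOn ℝ 1 u X) :
    ContinuousOn (gradient u) X :=
  (InnerProductSpace.toDual ℝ (EuclideanSpace ℝ (Fin n))).symm.continuous.comp_continuousOn
    (hu.continuousOn_fderiv_of_isOpen X.isOpen le_rfl)

theorem gradient_add_of_contDiffOn {X : TopologicalSpace.Opens (EuclideanSpace ℝ (Fin n))}
    {u v : EuclideanSpace ℝ (Fin n) → ℝ} (hu : ContDiffOn ℝ 1 u X) (hv : ContDiffOn ℝ 1 v X)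
    {x : EuclideanSpace ℝ (Fin n)} (hx : x ∈ X) :
    gradient (u + v) x = gradient u x + gradient v x := by
  have hX : (X : Set (EuclideanSpace ℝ (Fin n))) ∈ 𝓝 x := X.isOpen.mem_nhds hx
  have h1 : DifferentiableAt ℝ u x := (hu.contDiffAt hX).differentiableAt one_ne_zero
  have h2 : DifferentiableAt ℝ v x := (hv.contDiffAt hX).differentiableAt one_ne_zero
  simp only [gradient, fderiv_add h1 h2, map_add]

theorem gradient_smul_of_contDiffOn {X : TopologicalSpace.Opens (EuclideanSpace ℝ (Fin n))}
    {u : EuclideanSpace ℝ (Fin n) → ℝ} (hu : ContDiffOn ℝ 1 u X) (c : ℝ)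
    {x : EuclideanSpace ℝ (Fin n)} (hx : x ∈ X) :
    gradient (c • u) x = c • gradient u x := by
  have hX : (X : Set (EuclideanSpace ℝ (Fin n))) ∈ 𝓝 x := X.isOpen.mem_nhds hx
  have h1 : DifferentiableAt ℝ u x := (hu.contDiffAt hX).differentiableAt one_ne_zero
  simp only [gradient, fderiv_const_smul h1 c, map_smul]

/-- The extended norm `‖u‖_{W₁(ψ)} = ‖ |grad u| ‖_{G(ψ)} + ‖u‖_{G(ψ)}` over the domain `X`. -/
def sobolevENorm (X : TopologicalSpace.Opens (EuclideanSpace ℝ (Fin n))) (ψ : GrandWeight)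
    (u : EuclideanSpace ℝ (Fin n) → ℝ) : ℝ≥0∞ :=
  ψ.eNorm (fun x => ‖gradient u x‖) (volume.restrict (X : Set (EuclideanSpace ℝ (Fin n)))) +
    ψ.eNorm u (volume.restrict (X : Set (EuclideanSpace ℝ (Fin n))))

variable {X : TopologicalSpace.Opens (EuclideanSpace ℝ (Fin n))} {ψ : GrandWeight}

theorem sobolevENorm_zero : sobolevENorm X ψ 0 = 0 := by
  have h : (fun x : EuclideanSpace ℝ (Fin n) =>
      ‖gradient (0 : EuclideanSpace ℝ (Fin n) → ℝ) x‖) = 0 := by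
    funext x
    simp [gradient]
  rw [sobolevENorm, h, ψ.eNorm_zero, add_zero]

theorem sobolevENorm_add_le {u v : EuclideanSpace ℝ (Fin n) → ℝ} (hu : ContDiffOn ℝ 1 u X)
    (hv : ContDiffOn ℝ 1 v X) :
    sobolevENorm X ψ (u + v) ≤ sobolevENorm X ψ u + sobolevENorm X ψ v := by
  have hX := X.isOpen.measurableSet
  have h1 : ψ.eNorm (fun x => ‖gradient (u + v) x‖)
        (volume.restrict (X : Set (EuclideanSpace ℝ (Fin n)))) ≤
      ψ.eNorm (fun x => ‖gradient u x‖)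
          (volume.restrict (X : Set (EuclideanSpace ℝ (Fin n)))) +
        ψ.eNorm (fun x => ‖gradient v x‖)
          (volume.restrict (X : Set (EuclideanSpace ℝ (Fin n)))) := by
    refine le_trans (ψ.eNorm_mono ?_) (ψ.eNorm_add_le
      ((continuousOn_gradient hu).norm.aestronglyMeasurable hX)
      ((continuousOn_gradient hv).norm.aestronglyMeasurable hX))
    filter_upwards [ae_restrict_mem hX] with x hx
    rw [gradient_add_of_contDiffOn hu hv hx, norm_norm, Pi.add_apply]
    exact (norm_add_le _ _).trans (Real.le_norm_self _)
  have h2 := ψ.eNorm_add_le (hu.continuousOn.aestronglyMeasurable (μ := volume) hX)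
    (hv.continuousOn.aestronglyMeasurable (μ := volume) hX)
  calc _ ≤ _ := add_le_add h1 h2
    _ = _ := by rw [sobolevENorm, sobolevENorm]; ring

theorem sobolevENorm_smul (c : ℝ) {u : EuclideanSpace ℝ (Fin n) → ℝ} (hu : ContDiffOn ℝ 1 u X) :
    sobolevENorm X ψ (c • u) = ‖c‖ₑ * sobolevENorm X ψ u := by
  have h1 : (fun x => ‖gradient (c • u) x‖) =ᵐ[volume.restrict
      (X : Set (EuclideanSpace ℝ (Fin n)))] ‖c‖ • fun x => ‖gradient u x‖ := by
    filter_upwards [ae_restrict_mem X.isOpen.measurableSet] with x hx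
    rw [gradient_smul_of_contDiffOn hu c hx, norm_smul]
    rfl
  rw [sobolevENorm, sobolevENorm, ψ.eNorm_congr h1, ψ.eNorm_const_smul, ψ.eNorm_const_smul,
    mul_add, enorm_norm]

variable (X ψ) in
/-- The functions `u` on `X` that are continuously differentiable, tend to `0` at infinity, and
have finite `W₁(ψ)` norm. A function on `X` is represented by its extension by zero. -/
def sobolevGrandSubmodule : Submodule ℝ (EuclideanSpace ℝ (Fin n) → ℝ) where
  carrier := {u | ContDiffOn ℝ 1 u X ∧ (∀ x ∉ X, u x = 0) ∧
    Tendsto u (Bornology.cobounded (EuclideanSpace ℝ (Fin n))) (𝓝 0) ∧ sobolevENorm X ψ u < ∞}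
  zero_mem' := by
    refine ⟨contDiffOn_const, fun _ _ => rfl, tendsto_const_nhds, ?_⟩
    rw [sobolevENorm_zero]
    exact ENNReal.zero_lt_top
  add_mem' {u v} hu hv := by
    refine ⟨hu.1.add hv.1, fun x hx => ?_, ?_, ?_⟩
    · rw [Pi.add_apply, hu.2.1 x hx, hv.2.1 x hx, add_zero]
    · rw [← add_zero (0 : ℝ)]
      exact hu.2.2.1.add hv.2.2.1
    · exact (sobolevENorm_add_le hu.1 hv.1).trans_lt
        (ENNReal.add_lt_top.2 ⟨hu.2.2.2, hv.2.2.2⟩)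
  smul_mem' c u hu := by
    refine ⟨contDiffOn_const.smul hu.1, fun x hx => ?_, ?_, ?_⟩
    · rw [Pi.smul_apply, hu.2.1 x hx, smul_zero]
    · rw [← smul_zero c]
      exact hu.2.2.1.const_smul c
    · rw [sobolevENorm_smul c hu.1]
      exact ENNReal.mul_lt_top (by simp) hu.2.2.2

variable (X ψ) in
/-- The Sobolev grand Lebesgue space `W₁(ψ)` over the domain `X`. -/
def SobolevGrand : Type := sobolevGrandSubmodule X ψ

namespace SobolevGrand

instance : AddCommGroup (SobolevGrand X ψ) :=
  inferInstanceAs (AddCommGroup (sobolevGrandSubmodule X ψ))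

instance : Module ℝ (SobolevGrand X ψ) := inferInstanceAs (Module ℝ (sobolevGrandSubmodule X ψ))

instance : Norm (SobolevGrand X ψ) := ⟨fun u => (sobolevENorm X ψ u.1).toReal⟩

theorem normedSpaceCore : NormedSpace.Core ℝ (SobolevGrand X ψ) where
  norm_nonneg _ := ENNReal.toReal_nonneg
  norm_smul c u := by
    change (sobolevENorm X ψ (c • u.1)).toReal = ‖c‖ * (sobolevENorm X ψ u.1).toReal
    rw [sobolevENorm_smul c u.2.1, ENNReal.toReal_mul, toReal_enorm]
  norm_triangle u v := by
    change (sobolevENorm X ψ (u.1 + v.1)).toReal ≤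
      (sobolevENorm X ψ u.1).toReal + (sobolevENorm X ψ v.1).toReal
    rw [← ENNReal.toReal_add u.2.2.2.2.ne v.2.2.2.2.ne]
    exact ENNReal.toReal_mono (ENNReal.add_lt_top.2 ⟨u.2.2.2.2, v.2.2.2.2⟩).ne
      (sobolevENorm_add_le u.2.1 v.2.1)
  norm_eq_zero_iff u := by
    constructor
    · intro h
      have h0 : sobolevENorm X ψ u.1 = 0 :=
        ((ENNReal.toReal_eq_zero_iff _).1 h).resolve_right u.2.2.2.2.ne
      have h1 := ψ.ae_eq_zero_of_eNorm_eq_zero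
        (u.2.1.continuousOn.aestronglyMeasurable (μ := volume) X.isOpen.measurableSet)
        (add_eq_zero.1 h0).2
      have h2 := Measure.eqOn_open_of_ae_eq h1 X.isOpen u.2.1.continuousOn continuousOn_const
      refine Subtype.ext (funext fun x => ?_)
      by_cases hx : x ∈ X
      · exact h2 hx
      · exact u.2.2.1 x hx
    · rintro rfl
      change (sobolevENorm X ψ 0).toReal = 0
      rw [sobolevENorm_zero, ENNReal.toReal_zero]

instance : NormedAddCommGroup (SobolevGrand X ψ) := NormedAddCommGroup.ofCore normedSpaceCore

instance : NormedSpace ℝ (SobolevGrand X ψ) := NormedSpace.ofCore normedSpaceCore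

theorem measurable (u : SobolevGrand X ψ) : Measurable u.1 := by
  classical
  have h : u.1 = (X : Set (EuclideanSpace ℝ (Fin n))).piecewise u.1 (fun _ => 0) := by
    funext x
    by_cases hx : x ∈ (X : Set (EuclideanSpace ℝ (Fin n)))
    · rw [piecewise_eq_of_mem _ _ _ hx]
    · rw [piecewise_eq_of_notMem _ _ _ hx]
      exact u.2.2.1 x hx
  rw [h]
  exact u.2.1.continuousOn.measurable_piecewise continuousOn_const X.isOpen.measurableSet

end SobolevGrand

/-- The `m`-dimensional surface measure on a subset `Y` of `ℝⁿ`. -/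
def surfaceMeasure (m : ℕ) (Y : Set (EuclideanSpace ℝ (Fin n))) :
    Measure (EuclideanSpace ℝ (Fin n)) :=
  (Measure.euclideanHausdorffMeasure m).restrict Y

variable (X ψ) in
/-- The projection operator `B : u ↦ u|_Y`, with `u|_Y` taken modulo the surface measure of `Y`. -/
def projectionOperator (m : ℕ) (Y : Set (EuclideanSpace ℝ (Fin n))) :
    SobolevGrand X ψ →ₗ[ℝ] (EuclideanSpace ℝ (Fin n) →ₘ[surfaceMeasure m Y] ℝ) where
  toFun u := AEEqFun.mk u.1 u.measurable.aestronglyMeasurable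
  map_add' _ _ := rfl
  map_smul' _ _ := rfl

variable (X ψ) in
/-- The natural domain `{u ∈ W₁(ψ) : Bu ∈ G(ν)}` of the embedding operator, with the norm of
`W₁(ψ)`. It is all of `W₁(ψ)` whenever `‖Bu‖_{G(ν)} ≤ C ‖ |grad u| ‖_{G(ψ)}` holds. -/
def embeddingDomain (ν : GrandWeight) (m : ℕ) (Y : Set (EuclideanSpace ℝ (Fin n))) :
    Submodule ℝ (SobolevGrand X ψ) :=
  (grandSubmodule ν (surfaceMeasure m Y)).comap (projectionOperator X ψ m Y)

variable (X ψ) in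
/-- The Sobolev embedding operator `S u = Bu`, from `W₁(ψ)` to `G(ν)`. -/
def sobolevEmbedding (ν : GrandWeight) (m : ℕ) (Y : Set (EuclideanSpace ℝ (Fin n))) :
    embeddingDomain X ψ ν m Y →ₗ[ℝ] GrandLebesgue ν (surfaceMeasure m Y) :=
  ((projectionOperator X ψ m Y).domRestrict (embeddingDomain X ψ ν m Y)).codRestrict
    (grandSubmodule ν (surfaceMeasure m Y)) fun u => u.2

end Sobolev

end

/-! The relation `p = q n / (q + m)` is the critical one: it says `n / p - 1 = m / q`. For a bump of
radius `r ≤ 1` centred at a point of `Y`, the `L^p` norm of the gradient is at most of order `r ^ (n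
/ p - 1)`, and so is that of the bump itself, while the `L^q` norm of the trace is at least of order
`r ^ (m / q)`. Both sides therefore scale alike, and bumps satisfy a reversed Sobolev inequality
`‖u‖ ≤ C ‖S u‖` with `C` independent of `r` and of the centre.

Since `Y` contains an isometric image of an `m`-dimensional ball, it has room for infinitely many
such bumps with disjoint supports. After normalising the traces to norm one, the bumps stay bounded
in `W₁(ψ)`, and by monotonicity of the norm of `G(ν)` their traces are at mutual distance at least
one. No subsequence of the traces converges.

The comparison has to survive the suprema over exponents. This is `exists_scaleSup_le_trace`; the
two estimates for bumps are `sobolevENorm_indicator_le` and `le_eNorm_surfaceMeasure_indicator`. -/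

/-! ### A criterion for noncompactness. -/

/-- A linear operator admitting vectors `u k` with `‖u k‖ ≤ C ‖T (u k)‖` whose images are nonzero
and pairwise "orthogonal" in the sense of Birkhoff is not compact. -/
theorem not_isCompactOperator_of_birkhoff_orthogonal {E F : Type*} [NormedAddCommGroup E]
    [NormedSpace ℝ E] [NormedAddCommGroup F] [NormedSpace ℝ F] (T : E →ₗ[ℝ] F) (u : ℕ → E)
    (C : ℝ) (h0 : ∀ k, T (u k) ≠ 0) (hC : ∀ k, ‖u k‖ ≤ C * ‖T (u k)‖)
    (hsep : ∀ j k, j ≠ k → ∀ s t : ℝ, ‖s • T (u j)‖ ≤ ‖s • T (u j) - t • T (u k)‖) :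
    ¬ IsCompactOperator T := by
  intro hT
  obtain ⟨K, hK, hsub⟩ := hT.image_closedBall_subset_compact (f := T) C
  set w : ℕ → E := fun k => ‖T (u k)‖⁻¹ • u k with hw
  have hwK : ∀ k, T (w k) ∈ K := fun k => hsub ⟨w k, by
    have hpos : 0 < ‖T (u k)‖ := norm_pos_iff.2 (h0 k)
    rw [mem_closedBall_zero_iff, hw, norm_smul, norm_inv, norm_norm, inv_mul_le_iff₀ hpos, mul_comm]
    exact hC k, rfl⟩
  obtain ⟨a, -, φ, hφ, hlim⟩ := hK.tendsto_subseq hwK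
  obtain ⟨N, hN⟩ := Metric.cauchySeq_iff'.1 hlim.cauchySeq 1 one_pos
  have h1 := hN (N + 1) N.le_succ
  have hne : φ (N + 1) ≠ φ N := (hφ N.lt_succ_self).ne'
  -- With `s`, `t` the normalising factors, the orthogonality puts two images at distance at least
  -- one, against the Cauchy property with threshold one.
  have h2 := hsep _ _ hne ‖T (u (φ (N + 1)))‖⁻¹ ‖T (u (φ N))‖⁻¹
  rw [norm_smul, norm_inv, norm_norm, inv_mul_cancel₀ (norm_ne_zero_iff.2 (h0 _))] at h2
  simp only [Function.comp_apply, hw, map_smul, dist_eq_norm] at h1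
  exact absurd h1 h2.not_gt

/-! ### Balls inside a convex set, and bump functions. -/

/-- An `m`-dimensional convex set in Euclidean space, parametrized isometrically by `ℝᵐ`, contains
the image of a ball centred at the origin. -/
theorem Convex.exists_isometry_image_ball_subset {n m : ℕ} {Y : Set (EuclideanSpace ℝ (Fin n))}
    (hY : Convex ℝ Y) (hne : Y.Nonempty) (hm : Module.finrank ℝ (vectorSpan ℝ Y) = m) :
    ∃ f : EuclideanSpace ℝ (Fin m) → EuclideanSpace ℝ (Fin n), Isometry f ∧ Y ⊆ range f ∧
      ∃ ε > 0, f '' Metric.ball 0 ε ⊆ Y := by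
  subst hm
  -- A nonempty convex set in finite dimension has a relative interior point; it becomes the image
  -- of the origin.
  obtain ⟨_, p, hp, rfl⟩ := hne.intrinsicInterior hY
  let e := (stdOrthonormalBasis ℝ (vectorSpan ℝ Y)).repr
  have hdir : ∀ z, (e.symm z : EuclideanSpace ℝ (Fin n)) + p ∈ affineSpan ℝ Y := fun z =>
    AffineSubspace.vadd_mem_of_mem_direction
      (by rw [direction_affineSpan]; exact (e.symm z).2) p.2
  have hf : Isometry fun z => (e.symm z : EuclideanSpace ℝ (Fin n)) + p :=
    Isometry.of_dist_eq fun z w => by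
      rw [dist_add_right, ← e.symm.dist_map z w]; rfl
  refine ⟨fun z => e.symm z + p, hf, fun y hy => ?_, ?_⟩
  · have : y - p ∈ vectorSpan ℝ Y := by
      rw [← direction_affineSpan]
      exact AffineSubspace.vsub_mem_direction (subset_affineSpan ℝ Y hy) p.2
    exact ⟨e ⟨_, this⟩, by simp⟩
  · rw [mem_interior_iff_mem_nhds, Metric.mem_nhds_iff] at hp
    obtain ⟨ε, hε, hball⟩ := hp
    refine ⟨ε, hε, ?_⟩
    rintro _ ⟨z, hz, rfl⟩
    have hmem : (⟨_, hdir z⟩ : affineSpan ℝ Y) ∈ Metric.ball p ε := by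
      rw [Metric.mem_ball, Subtype.dist_eq, dist_eq_norm]
      have hz' : ‖(e.symm z : EuclideanSpace ℝ (Fin n))‖ = ‖z‖ := e.symm.norm_map z
      simpa [hz'] using hz
    exact hball hmem

/-- Rescaled bump functions: equal to `1` on the ball of radius `r`, supported in the ball of
radius `2 r`, with gradient of size `1 / r`. -/
theorem exists_bump_fderiv_le (E : Type*) [NormedAddCommGroup E] [InnerProductSpace ℝ E]
    [FiniteDimensional ℝ E] :
    ∃ L : ℝ, 0 ≤ L ∧ ∀ (y : E) (r : ℝ), 0 < r → ∃ v : E → ℝ, ContDiff ℝ 1 v ∧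
      (∀ x, ‖v x‖ ≤ 1) ∧ (∀ x ∈ Metric.closedBall y r, v x = 1) ∧
      (∀ x ∉ Metric.closedBall y (2 * r), v x = 0) ∧ (∀ x, ‖fderiv ℝ v x‖ ≤ L / r) ∧
      ∀ x ∉ Metric.closedBall y (2 * r), fderiv ℝ v x = 0 := by
  let φ : ContDiffBump (0 : E) := ⟨1, 2, one_pos, one_lt_two⟩
  have hφ : ContDiff ℝ 1 φ := φ.contDiff
  have hd : Continuous (fderiv ℝ φ) := hφ.continuous_fderiv one_ne_zero
  obtain ⟨L, hL⟩ := (φ.hasCompactSupport.fderiv ℝ).exists_bound_of_continuous hd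
  refine ⟨L, (norm_nonneg _).trans (hL 0), fun y r hr => ?_⟩
  have hder : ∀ x, HasFDerivAt (fun x => φ (r⁻¹ • (x - y)))
      ((fderiv ℝ φ (r⁻¹ • (x - y))).comp (r⁻¹ • ContinuousLinearMap.id ℝ E)) x := fun x =>
    ((hφ.differentiable one_ne_zero) _).hasFDerivAt.comp x
      (((hasFDerivAt_id x).sub_const y).const_smul r⁻¹)
  have hnorm : ∀ x, ‖r⁻¹ • (x - y)‖ = dist x y / r := fun x => by
    rw [norm_smul, norm_inv, Real.norm_of_nonneg hr.le, dist_eq_norm, div_eq_inv_mul]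
  -- Leaving the closed support, and not only the support, makes the derivative vanish as well.
  have hout : ∀ x ∉ Metric.closedBall y (2 * r), r⁻¹ • (x - y) ∉ tsupport φ := by
    intro x hx
    rw [φ.tsupport_eq, mem_closedBall_zero_iff, hnorm, div_le_iff₀ hr]
    exact hx
  refine ⟨fun x => φ (r⁻¹ • (x - y)), by fun_prop, fun x => ?_, fun x hx => ?_, fun x hx => ?_,
    fun x => ?_, fun x hx => ?_⟩
  · rw [Real.norm_of_nonneg φ.nonneg]
    exact φ.le_one
  · apply φ.one_of_mem_closedBall
    rw [mem_closedBall_zero_iff, hnorm]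
    change _ ≤ (1 : ℝ)
    rw [div_le_one hr]
    exact hx
  · exact image_eq_zero_of_notMem_tsupport (hout x hx)
  · rw [(hder x).fderiv, ContinuousLinearMap.comp_smul, ContinuousLinearMap.comp_id, norm_smul,
      norm_inv, Real.norm_of_nonneg hr.le, div_eq_inv_mul]
    exact mul_le_mul_of_nonneg_left (hL _) (inv_nonneg.2 hr.le)
  · have h0 : fderiv ℝ φ (r⁻¹ • (x - y)) = 0 :=
      image_eq_zero_of_notMem_tsupport fun h => hout x hx (tsupport_fderiv_subset ℝ h)
    rw [(hder x).fderiv, h0, ContinuousLinearMap.zero_comp]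

/-! ### Estimates of `L^p` norms uniform in the exponent. -/

theorem eLpNorm_le_of_norm_le_of_eq_zero {α : Type*} [MeasurableSpace α] {μ : Measure α}
    {f : α → ℝ} {S : Set α} (hS : MeasurableSet S) {M p : ℝ} (hp : 0 < p)
    (hM : ∀ᵐ x ∂μ, ‖f x‖ ≤ M) (h0 : ∀ᵐ x ∂μ, x ∉ S → f x = 0) :
    eLpNorm f (ENNReal.ofReal p) μ ≤ ENNReal.ofReal M * μ S ^ (1 / p) := by
  rcases lt_or_ge M 0 with hneg | hM0
  · have : ∀ᵐ x ∂μ, False := hM.mono fun x hx => absurd (norm_nonneg (f x)) (by linarith)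
    have hμ : μ = 0 := by simpa using this
    simp [hμ]
  calc eLpNorm f (ENNReal.ofReal p) μ
      ≤ eLpNorm (S.indicator fun _ => M) (ENNReal.ofReal p) μ := eLpNorm_mono_ae <| by
        filter_upwards [hM, h0] with x h1 h2
        by_cases hx : x ∈ S
        · rw [indicator_of_mem hx, Real.norm_of_nonneg hM0]
          exact h1
        · rw [h2 hx, norm_zero]
          exact norm_nonneg _
    _ = _ := by
        rw [eLpNorm_indicator_const hS (by simpa using hp) ENNReal.ofReal_ne_top,
          ENNReal.toReal_ofReal hp.le, Real.enorm_of_nonneg hM0]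

theorem le_eLpNorm_of_eq_one {α : Type*} [MeasurableSpace α] {μ : Measure α}
    {f : α → ℝ} {S : Set α} (hS : MeasurableSet S) {p : ℝ} (hp : 0 < p)
    (h1 : ∀ᵐ x ∂μ, x ∈ S → f x = 1) :
    μ S ^ (1 / p) ≤ eLpNorm f (ENNReal.ofReal p) μ := by
  calc μ S ^ (1 / p) = eLpNorm (S.indicator fun _ => (1 : ℝ)) (ENNReal.ofReal p) μ := by
        rw [eLpNorm_indicator_const hS (by simpa using hp) ENNReal.ofReal_ne_top,
          ENNReal.toReal_ofReal hp.le, enorm_one, one_mul]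
    _ ≤ _ := eLpNorm_mono_ae <| by
        filter_upwards [h1] with x hx
        by_cases hxS : x ∈ S
        · rw [indicator_of_mem hxS, hx hxS]
        · rw [indicator_of_notMem hxS, norm_zero]
          exact norm_nonneg _

/-- As `0 < 1 / p ≤ 1`, the power `c ^ (1 / p)` lies between `min 1 c` and `max 1 c`. These replace
the volume factors by constants free of `p`, which can be taken out of a supremum. -/
theorem ENNReal.rpow_one_div_le_max_one (c : ℝ≥0∞) {p : ℝ} (hp : 1 ≤ p) :
    c ^ (1 / p) ≤ max 1 c := by
  have hp1 : 1 / p ≤ 1 := (div_le_one (by linarith)).2 hp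
  have hp0 : 0 ≤ 1 / p := by positivity
  calc c ^ (1 / p) ≤ max 1 c ^ (1 / p) := ENNReal.rpow_le_rpow (le_max_right _ _) hp0
    _ ≤ max 1 c ^ (1 : ℝ) := ENNReal.rpow_le_rpow_of_exponent_le (le_max_left _ _) hp1
    _ = _ := ENNReal.rpow_one _

theorem ENNReal.min_one_le_rpow_one_div (c : ℝ≥0∞) {p : ℝ} (hp : 1 ≤ p) :
    min 1 c ≤ c ^ (1 / p) := by
  have hp1 : 1 / p ≤ 1 := (div_le_one (by linarith)).2 hp
  have hp0 : 0 ≤ 1 / p := by positivity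
  calc min 1 c = min 1 c ^ (1 : ℝ) := (ENNReal.rpow_one _).symm
    _ ≤ min 1 c ^ (1 / p) := ENNReal.rpow_le_rpow_of_exponent_ge (min_le_left _ _) hp1
    _ ≤ c ^ (1 / p) := ENNReal.rpow_le_rpow (min_le_right _ _) hp0

/-! ### Scale suprema and the critical exponent. -/

noncomputable section

namespace GrandWeight

/-- The extended norm `⨆ p, r ^ s(p) / ψ(p)` of a power of the scale `r`, where the exponent may
depend on `p`. -/
def scaleSup (ψ : GrandWeight) (s : ℝ → ℝ) (r : ℝ) : ℝ≥0∞ :=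
  ⨆ p ∈ Ioo ψ.a ψ.b, ENNReal.ofReal (r ^ s p) / ENNReal.ofReal (ψ.toFun p)

theorem eNorm_le_mul_scaleSup {α : Type*} [MeasurableSpace α] (ψ : GrandWeight) {μ : Measure α}
    {f : α → ℝ} {s : ℝ → ℝ} {r : ℝ} {K : ℝ≥0∞}
    (h : ∀ p ∈ Ioo ψ.a ψ.b, eLpNorm f (ENNReal.ofReal p) μ ≤ K * ENNReal.ofReal (r ^ s p)) :
    ψ.eNorm f μ ≤ K * ψ.scaleSup s r := by
  refine iSup₂_le fun p hp => (ENNReal.div_le_div_right (h p hp) _).trans ?_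
  rw [mul_div_assoc]
  gcongr
  exact le_iSup₂ (f := fun p (_ : p ∈ Ioo ψ.a ψ.b) =>
    ENNReal.ofReal (r ^ s p) / ENNReal.ofReal (ψ.toFun p)) p hp

theorem mul_scaleSup_le_eNorm {α : Type*} [MeasurableSpace α] (ψ : GrandWeight) {μ : Measure α}
    {f : α → ℝ} {s : ℝ → ℝ} {r : ℝ} {K : ℝ≥0∞}
    (h : ∀ p ∈ Ioo ψ.a ψ.b, K * ENNReal.ofReal (r ^ s p) ≤ eLpNorm f (ENNReal.ofReal p) μ) :
    K * ψ.scaleSup s r ≤ ψ.eNorm f μ := by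
  simp only [scaleSup, ENNReal.mul_iSup, ← mul_div_assoc]
  exact iSup₂_mono fun p hp => ENNReal.div_le_div_right (h p hp) _

/-- The weight is bounded away from zero, so division by it costs only a constant. This shows that
traces of bumps lie in `G(ν)` without any Sobolev inequality. -/
theorem eNorm_lt_top_of_forall_eLpNorm_le {α : Type*} [MeasurableSpace α] (ψ : GrandWeight)
    {μ : Measure α} {f : α → ℝ} {K : ℝ≥0∞} (hK : K ≠ ∞)
    (h : ∀ p ∈ Ioo ψ.a ψ.b, eLpNorm f (ENNReal.ofReal p) μ ≤ K) : ψ.eNorm f μ < ∞ := by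
  obtain ⟨c, hc, hψ⟩ := ψ.exists_pos_le
  refine lt_of_le_of_lt (b := K / ENNReal.ofReal c) (iSup₂_le fun p hp => ?_)
    (ENNReal.div_lt_top hK (by simpa using hc))
  exact ENNReal.div_le_div (h p hp) (ENNReal.ofReal_le_ofReal (hψ p hp))

/-- For `m = 0` the endpoint `B₂` is zero, whereas `A₂ ≥ 1`. -/
theorem cast_pos_of_A₂_lt_B₂ (ψ : GrandWeight) {n m : ℕ} (hAB : ψ.A₂ n m < ψ.B₂ n m) :
    (0 : ℝ) < m := by
  have h1 : 1 < ψ.B₂ n m := (le_max_left _ _).trans_lt hAB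
  rcases Nat.eq_zero_or_pos m with rfl | h
  · simp only [B₂, Nat.cast_zero, mul_zero, zero_div] at h1
    linarith
  · exact_mod_cast h

/-- The critical scaling `n / p - 1 = m / q` makes the scale suprema of `ψ` and of its trace weight
comparable, uniformly in `0 < r ≤ 1`. -/
theorem exists_scaleSup_le_trace (ψ : GrandWeight) {n m : ℕ} (hb : ψ.b < n)
    (hAB : ψ.A₂ n m < ψ.B₂ n m) :
    ∃ D : ℝ≥0∞, D ≠ ∞ ∧ ∀ r : ℝ, 0 < r → r ≤ 1 →
      ψ.scaleSup (fun p => n / p - 1) r ≤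
        D * (ψ.trace n m hb hAB).scaleSup (fun q => m / q) r := by
  have hm := ψ.cast_pos_of_A₂_lt_B₂ hAB
  have hn : (0 : ℝ) < n := by linarith [ψ.one_le_a, ψ.a_lt_b]
  obtain ⟨c, hc, hψ⟩ := ψ.exists_pos_le
  -- Because of the cut-off at 1 in `A₂`, small `p` may have no partner `q > A₂`. The pair `(p₀,
  -- q₀)` serves as a substitute for all `p ≤ p₀`.
  obtain ⟨q₀, hq₀⟩ := nonempty_Ioo.2 hAB
  have hp₀ := ψ.exponent_mem hb hq₀
  set p₀ := q₀ * n / (q₀ + m) with hp₀_def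
  have hB : 1 ≤ ψ.B₂ n m := (le_max_left _ _).trans hAB.le
  have hψp₀ : 0 < ψ.toFun p₀ := ψ.pos hp₀
  -- The factor `B₂` absorbs `q ^ (1 - 1 / n) ≤ q`, and `ψ(p₀) / c` pays for using `p₀` in place of
  -- `p`.
  refine ⟨ENNReal.ofReal (ψ.B₂ n m * max 1 (ψ.toFun p₀ / c)), ENNReal.ofReal_ne_top,
    fun r hr hr1 => iSup₂_le fun p hp => ?_⟩
  have hp1 : 1 < p := ψ.one_le_a.trans_lt hp.1
  -- a single exponent `q` of the trace weight dominates the term with index `p`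
  suffices h : ∃ q ∈ Ioo (ψ.A₂ n m) (ψ.B₂ n m), r ^ (n / p - 1) / ψ.toFun p ≤
      max 1 (ψ.toFun p₀ / c) * (r ^ (m / q) / ψ.toFun (q * n / (q + m))) by
    obtain ⟨q, hq, hle⟩ := h
    have hq1 : 1 < q := (le_max_left _ _).trans_lt hq.1
    have hqψ : 0 < ψ.toFun (q * n / (q + m)) := ψ.pos (ψ.exponent_mem hb hq)
    have hqn : q ^ (1 - 1 / (n : ℝ)) ≤ ψ.B₂ n m := by
      calc q ^ (1 - 1 / (n : ℝ)) ≤ q ^ (1 : ℝ) :=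
            Real.rpow_le_rpow_of_exponent_le hq1.le (by
              have : 0 ≤ 1 / (n : ℝ) := by positivity
              linarith)
        _ = q := Real.rpow_one q
        _ ≤ _ := hq.2.le
    have hνq : 0 < q ^ (1 - 1 / (n : ℝ)) := Real.rpow_pos_of_pos (by linarith) _
    have hν : (ψ.trace n m hb hAB).toFun q =
      q ^ (1 - 1 / (n : ℝ)) * ψ.toFun (q * n / (q + m)) := rfl
    have hreal : r ^ (n / p - 1) / ψ.toFun p ≤
        ψ.B₂ n m * max 1 (ψ.toFun p₀ / c) * (r ^ (m / q) / (ψ.trace n m hb hAB).toFun q) := by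
      refine hle.trans ?_
      rw [hν, mul_comm (ψ.B₂ n m), mul_assoc]
      refine mul_le_mul_of_nonneg_left ?_ (by positivity)
      rw [mul_div_assoc', div_le_div_iff₀ hqψ (by positivity)]
      have : 0 ≤ r ^ (m / q) * ψ.toFun (q * n / (q + m)) := by positivity
      nlinarith
    rw [← ENNReal.ofReal_div_of_pos (ψ.pos hp)]
    refine (ENNReal.ofReal_le_ofReal hreal).trans ?_
    rw [ENNReal.ofReal_mul (by positivity),
      ENNReal.ofReal_div_of_pos ((ψ.trace n m hb hAB).pos hq)]
    gcongr
    exact le_iSup₂ (f := fun q (_ : q ∈ Ioo (ψ.trace n m hb hAB).a (ψ.trace n m hb hAB).b) =>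
      ENNReal.ofReal (r ^ (m / q)) / ENNReal.ofReal ((ψ.trace n m hb hAB).toFun q)) q hq
  rcases le_or_gt p p₀ with hle | hlt
  -- As `r ≤ 1`, lowering the exponent from `n / p - 1` to `n / p₀ - 1` can only increase the power.
  · refine ⟨q₀, hq₀, ?_⟩
    have hq1 : 1 < q₀ := (le_max_left _ _).trans_lt hq₀.1
    have hexp : (m : ℝ) / q₀ = n / p₀ - 1 := by
      rw [hp₀_def]
      field_simp
      ring
    rw [← hp₀_def, hexp]
    have h1 : r ^ (n / p - 1) ≤ r ^ (n / p₀ - 1) :=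
      Real.rpow_le_rpow_of_exponent_ge hr hr1 (by gcongr)
    calc r ^ (n / p - 1) / ψ.toFun p ≤ r ^ (n / p₀ - 1) / c := by
          gcongr
          exact hψ p hp
      _ = ψ.toFun p₀ / c * (r ^ (n / p₀ - 1) / ψ.toFun p₀) := by field_simp
      _ ≤ _ := by
          gcongr
          exact le_max_right _ _
  -- Here the exact partner `q = p m / (n - p)`, the inverse of `q ↦ q n / (q + m)`, is admissible:
  -- it exceeds `q₀` since `p > p₀`.
  · have hpn : 0 < n - p := by linarith [hp.2]
    have hbn : 0 < n - ψ.b := by linarith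
    have hq₀1 : 1 < q₀ := (le_max_left _ _).trans_lt hq₀.1
    have hpq : p * m / (n - p) * n / (p * m / (n - p) + m) = p := by
      have : p * m + m * (n - p) ≠ 0 := by
        have : p * m + m * (n - p) = m * n := by ring
        rw [this]
        positivity
      field_simp
      ring
    refine ⟨p * m / (n - p), ⟨hq₀.1.trans ?_, ?_⟩, ?_⟩
    · rw [hp₀_def, div_lt_iff₀ (by linarith)] at hlt
      rw [lt_div_iff₀ hpn]
      linarith
    · have hb0 : 0 < ψ.b := by linarith [hp.2]
      have := hp.2
      rw [B₂]
      gcongr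
    · have hexp : (m : ℝ) / (p * m / (n - p)) = n / p - 1 := by
        field_simp
      rw [hpq, hexp]
      have : 0 ≤ r ^ (n / p - 1) / ψ.toFun p := by
        have := ψ.pos hp
        positivity
      exact le_mul_of_one_le_left this (le_max_left _ _)

end GrandWeight

theorem ENNReal.ofReal_pow_mul_rpow_one_div {r : ℝ} (hr : 0 ≤ r) (d : ℕ) (c : ℝ≥0∞) {p : ℝ}
    (hp : 0 < p) : (ENNReal.ofReal (r ^ d) * c) ^ (1 / p) =
      ENNReal.ofReal (r ^ ((d : ℝ) / p)) * c ^ (1 / p) := by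
  rw [ENNReal.mul_rpow_of_nonneg _ _ (by positivity),
    ENNReal.ofReal_rpow_of_nonneg (by positivity) (by positivity), ← Real.rpow_natCast,
    ← Real.rpow_mul hr, mul_one_div]

/-! ### Norms of bumps on the domain and on the trace. -/

section Bump

variable {n m : ℕ}

/-- The `W₁(ψ)` norm of a bump function of radius `r` scales like `r ^ (n / p - 1)`. -/
theorem sobolevENorm_indicator_le (X : TopologicalSpace.Opens (EuclideanSpace ℝ (Fin n)))
    (ψ : GrandWeight) {v : EuclideanSpace ℝ (Fin n) → ℝ} {y : EuclideanSpace ℝ (Fin n)} {r L : ℝ}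
    (hr : 0 < r) (hr1 : r ≤ 1) (hL : 0 ≤ L) (hv1 : ∀ x, ‖v x‖ ≤ 1)
    (hv0 : ∀ x ∉ Metric.closedBall y (2 * r), v x = 0) (hd : ∀ x, ‖fderiv ℝ v x‖ ≤ L / r)
    (hd0 : ∀ x ∉ Metric.closedBall y (2 * r), fderiv ℝ v x = 0) :
    sobolevENorm X ψ ((X : Set (EuclideanSpace ℝ (Fin n))).indicator v) ≤
      ENNReal.ofReal (L + 1) * max 1 (ENNReal.ofReal (2 ^ n) *
        volume (Metric.ball (0 : EuclideanSpace ℝ (Fin n)) 1)) *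
        ψ.scaleSup (fun p => n / p - 1) r := by
  set u := (X : Set (EuclideanSpace ℝ (Fin n))).indicator v with hu
  -- The ball of radius `2 r` has volume `r ^ n * W`.
  set W := ENNReal.ofReal (2 ^ n) * volume (Metric.ball (0 : EuclideanSpace ℝ (Fin n)) 1)
  have hXm : MeasurableSet (X : Set (EuclideanSpace ℝ (Fin n))) := X.isOpen.measurableSet
  have hgrad : ∀ x ∈ X, ‖gradient u x‖ = ‖fderiv ℝ v x‖ := fun x hx => by
    have : u =ᶠ[𝓝 x] v := by
      filter_upwards [X.isOpen.mem_nhds hx] with z hz using indicator_of_mem hz v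
    rw [gradient, LinearIsometryEquiv.norm_map, this.fderiv_eq]
  have hball : ∀ p : ℝ, 1 ≤ p →
      (volume.restrict (X : Set (EuclideanSpace ℝ (Fin n))) (Metric.closedBall y (2 * r))) ^ (1 / p)
        ≤ ENNReal.ofReal (r ^ ((n : ℝ) / p)) * max 1 W := fun p hp => by
    have hp0 : 0 < p := by linarith
    calc _ ≤ (volume (Metric.closedBall y (2 * r))) ^ (1 / p) :=
          ENNReal.rpow_le_rpow (Measure.restrict_apply_le _ _) (by positivity)
      _ = (ENNReal.ofReal (r ^ n) * W) ^ (1 / p) := by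
          rw [Measure.addHaar_closedBall _ _ (by positivity), finrank_euclideanSpace_fin,
            mul_comm 2 r, mul_pow, ENNReal.ofReal_mul (by positivity), mul_assoc]
      _ = ENNReal.ofReal (r ^ ((n : ℝ) / p)) * W ^ (1 / p) :=
          ENNReal.ofReal_pow_mul_rpow_one_div hr.le n W hp0
      _ ≤ _ := by
          gcongr
          exact ENNReal.rpow_one_div_le_max_one W hp
  -- Used for the gradient with `M = L` and for the bump with `M = 1`; the latter fits because `1 ≤
  -- 1 / r`.
  have hgen : ∀ (f : EuclideanSpace ℝ (Fin n) → ℝ) (M : ℝ), 0 ≤ M → (∀ x ∈ X, ‖f x‖ ≤ M / r) →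
      (∀ x ∈ X, x ∉ Metric.closedBall y (2 * r) → f x = 0) →
      ψ.eNorm f (volume.restrict (X : Set (EuclideanSpace ℝ (Fin n)))) ≤
        ENNReal.ofReal M * max 1 W * ψ.scaleSup (fun p => n / p - 1) r := by
    intro f M hM hf hf0
    refine ψ.eNorm_le_mul_scaleSup fun p hp => ?_
    have hp1 : 1 ≤ p := ψ.one_le_a.trans hp.1.le
    calc _ ≤ ENNReal.ofReal (M / r) * _ :=
          eLpNorm_le_of_norm_le_of_eq_zero Metric.isClosed_closedBall.measurableSet
            (by linarith) ((ae_restrict_mem hXm).mono hf) ((ae_restrict_mem hXm).mono hf0)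
      _ ≤ ENNReal.ofReal (M / r) * (ENNReal.ofReal (r ^ ((n : ℝ) / p)) * max 1 W) := by
          gcongr
          exact hball p hp1
      _ = ENNReal.ofReal M * max 1 W * ENNReal.ofReal (r ^ ((n : ℝ) / p - 1)) := by
          rw [← mul_assoc, ← ENNReal.ofReal_mul (by positivity), mul_right_comm,
            ← ENNReal.ofReal_mul hM, Real.rpow_sub_one hr.ne']
          ring_nf
  have h1 := hgen (fun x => ‖gradient u x‖) L hL
    (fun x hx => by rw [norm_norm, hgrad x hx]; exact hd x)
    (fun x hx hxb => by rw [hgrad x hx, hd0 x hxb, norm_zero])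
  have h2 := hgen u 1 zero_le_one
    (fun x hx => by
      rw [hu, indicator_of_mem hx]
      exact (hv1 x).trans ((one_le_div hr).2 hr1))
    (fun x hx hxb => by rw [hu, indicator_of_mem hx, hv0 x hxb])
  calc _ ≤ _ := add_le_add h1 h2
    _ = _ := by rw [ENNReal.ofReal_add hL zero_le_one, add_mul, add_mul]

/-- Isometries preserve the normalised Hausdorff measure, which on `ℝᵐ` is Lebesgue measure. -/
theorem volume_ball_le_surfaceMeasure {Y : Set (EuclideanSpace ℝ (Fin n))}
    {f : EuclideanSpace ℝ (Fin m) → EuclideanSpace ℝ (Fin n)} (hf : Isometry f)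
    {z : EuclideanSpace ℝ (Fin m)} {r : ℝ} (hY : f '' Metric.ball z r ⊆ Y) :
    volume (Metric.ball z r) ≤ surfaceMeasure m Y (Metric.closedBall (f z) r) := by
  rw [surfaceMeasure, Measure.restrict_apply Metric.isClosed_closedBall.measurableSet,
    ← EuclideanSpace.euclideanHausdorffMeasure_eq_volume, ← hf.euclideanHausdorffMeasure_image]
  refine measure_mono (subset_inter ?_ hY)
  rintro _ ⟨w, hw, rfl⟩
  rw [Metric.mem_closedBall, hf.dist_eq]
  exact (Metric.mem_ball.1 hw).le

/-- The part of `Y` in the ball sits inside the isometric image of a ball of `ℝᵐ`. -/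
theorem surfaceMeasure_closedBall_lt_top {Y : Set (EuclideanSpace ℝ (Fin n))}
    {f : EuclideanSpace ℝ (Fin m) → EuclideanSpace ℝ (Fin n)} (hf : Isometry f)
    (hY : Y ⊆ range f) (z : EuclideanSpace ℝ (Fin m)) (r : ℝ) :
    surfaceMeasure m Y (Metric.closedBall (f z) r) < ∞ := by
  rw [surfaceMeasure, Measure.restrict_apply Metric.isClosed_closedBall.measurableSet]
  refine (measure_mono (t := f '' Metric.closedBall z r) ?_).trans_lt ?_
  · rintro x ⟨hx, hxY⟩
    obtain ⟨w, rfl⟩ := hY hxY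
    exact ⟨w, by rwa [Metric.mem_closedBall, hf.dist_eq] at hx, rfl⟩
  · rw [hf.euclideanHausdorffMeasure_image, EuclideanSpace.euclideanHausdorffMeasure_eq_volume]
    exact measure_closedBall_lt_top

end Bump

end

/-- The trace norm of a bump function of radius `r` is at least of the order `r ^ (m / q)`. -/
theorem le_eNorm_surfaceMeasure_indicator {n m : ℕ}
    {X : TopologicalSpace.Opens (EuclideanSpace ℝ (Fin n))} {Y : Set (EuclideanSpace ℝ (Fin n))}
    (hYX : Y ⊆ X) (ν : GrandWeight) {f : EuclideanSpace ℝ (Fin m) → EuclideanSpace ℝ (Fin n)}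
    (hf : Isometry f) {z : EuclideanSpace ℝ (Fin m)} {r : ℝ} (hr : 0 < r)
    (hY : f '' Metric.ball z r ⊆ Y) {v : EuclideanSpace ℝ (Fin n) → ℝ}
    (hv1 : ∀ x ∈ Metric.closedBall (f z) r, v x = 1) :
    min 1 (volume (Metric.ball (0 : EuclideanSpace ℝ (Fin m)) 1)) *
      ν.scaleSup (fun q => m / q) r ≤
      ν.eNorm ((X : Set (EuclideanSpace ℝ (Fin n))).indicator v) (surfaceMeasure m Y) := by
  refine ν.mul_scaleSup_le_eNorm fun q hq => ?_
  have hq1 : 1 ≤ q := ν.one_le_a.trans hq.1.le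
  have hq0 : 0 < q := by linarith
  refine le_trans ?_ (le_eLpNorm_of_eq_one
    (Metric.isClosed_closedBall (x := f z) (ε := r)).measurableSet hq0 ?_)
  · calc _ ≤ volume (Metric.ball (0 : EuclideanSpace ℝ (Fin m)) 1) ^ (1 / q) *
          ENNReal.ofReal (r ^ ((m : ℝ) / q)) := by
          gcongr
          exact ENNReal.min_one_le_rpow_one_div _ hq1
      _ = volume (Metric.ball z r) ^ (1 / q) := by
          rw [Measure.addHaar_ball_of_pos _ _ hr, finrank_euclideanSpace_fin,
            ENNReal.ofReal_pow_mul_rpow_one_div hr.le m _ hq0, mul_comm]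
      _ ≤ _ := ENNReal.rpow_le_rpow (volume_ball_le_surfaceMeasure hf hY) (by positivity)
  -- Membership in the open set `X` holds almost everywhere on `Y` with no measurability of `Y`.
  · filter_upwards [ae_restrict_of_ae_restrict_of_subset hYX
      (ae_restrict_mem X.isOpen.measurableSet)] with x hxX hx
    rw [indicator_of_mem hxX, hv1 x hx]

/-! ### Traces and disjoint supports. -/

theorem norm_sobolevEmbedding {n m : ℕ} {X : TopologicalSpace.Opens (EuclideanSpace ℝ (Fin n))}
    {ψ ν : GrandWeight} {Y : Set (EuclideanSpace ℝ (Fin n))} (u : embeddingDomain X ψ ν m Y) :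
    ‖sobolevEmbedding X ψ ν m Y u‖ = (ν.eNorm u.1.1 (surfaceMeasure m Y)).toReal :=
  congrArg ENNReal.toReal (ν.eNorm_congr (AEEqFun.coeFn_mk _ _))

theorem eNorm_lt_top_of_mem_embeddingDomain {n m : ℕ}
    {X : TopologicalSpace.Opens (EuclideanSpace ℝ (Fin n))}
    {ψ ν : GrandWeight} {Y : Set (EuclideanSpace ℝ (Fin n))} (u : embeddingDomain X ψ ν m Y) :
    ν.eNorm u.1.1 (surfaceMeasure m Y) < ∞ := by
  rw [← ν.eNorm_congr (AEEqFun.coeFn_mk u.1.1 u.1.measurable.aestronglyMeasurable)]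
  exact u.2

/-- Functions with disjoint supports have Birkhoff orthogonal traces. -/
theorem norm_smul_sobolevEmbedding_le_of_disjoint {n m : ℕ}
    {X : TopologicalSpace.Opens (EuclideanSpace ℝ (Fin n))}
    {ψ ν : GrandWeight} {Y : Set (EuclideanSpace ℝ (Fin n))} (u w : embeddingDomain X ψ ν m Y)
    (h : ∀ x, u.1.1 x = 0 ∨ w.1.1 x = 0) (s t : ℝ) :
    ‖s • sobolevEmbedding X ψ ν m Y u‖ ≤
      ‖s • sobolevEmbedding X ψ ν m Y u - t • sobolevEmbedding X ψ ν m Y w‖ := by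
  rw [← map_smul, ← map_smul, ← map_sub, norm_sobolevEmbedding, norm_sobolevEmbedding]
  refine ENNReal.toReal_mono (eNorm_lt_top_of_mem_embeddingDomain _).ne
    (ν.eNorm_mono (Eventually.of_forall fun x => ?_))
  change ‖s * u.1.1 x‖ ≤ ‖s * u.1.1 x - t * w.1.1 x‖
  rcases h x with h | h
  · rw [h, mul_zero, norm_zero]
    exact norm_nonneg _
  · rw [h, mul_zero, sub_zero]

/-- A sequence of points tending to the origin inside a ball, with pairwise disjoint balls
around them. -/
theorem exists_seq_disjoint_balls {E : Type*} [NormedAddCommGroup E] [NormedSpace ℝ E]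
    [Nontrivial E] {ε : ℝ} (hε : 0 < ε) :
    ∃ (z : ℕ → E) (r : ℕ → ℝ), (∀ k, 0 < r k) ∧ (∀ k, r k ≤ 1) ∧
      (∀ k, Metric.ball (z k) (r k) ⊆ Metric.ball 0 ε) ∧
      ∀ j k, j ≠ k → 2 * r j + 2 * r k < dist (z j) (z k) := by
  obtain ⟨e, he⟩ := exists_norm_eq E zero_le_one
  set δ := min 1 (ε / 2) with hδ
  have hδ0 : 0 < δ := by positivity
  have hδ1 : δ ≤ 1 := min_le_left _ _
  have hδε : δ ≤ ε / 2 := min_le_right _ _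
  have hρ0 : ∀ k : ℕ, 0 < δ * (1 / 2) ^ k := fun k => by positivity
  have hρ1 : ∀ k : ℕ, δ * (1 / 2) ^ k ≤ δ := fun k =>
    mul_le_of_le_one_right hδ0.le (pow_le_one₀ (by norm_num) (by norm_num))
  -- For `j < k` the centres are at least `δ 2⁻ʲ / 2` apart, while the doubled radii add up to at
  -- most `3 / 8` of `δ 2⁻ʲ`.
  refine ⟨fun k => (δ * (1 / 2) ^ k) • e, fun k => δ * (1 / 2) ^ k / 8, fun k => ?_, fun k => ?_,
    fun k => ?_, ?_⟩
  · have := hρ0 k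
    positivity
  · linarith [hρ1 k, hρ0 k]
  · refine Metric.ball_subset_ball' ?_
    rw [dist_zero_right, norm_smul, he, mul_one, Real.norm_of_nonneg (hρ0 k).le]
    linarith [hρ1 k, hρ0 k]
  · have key : ∀ j k : ℕ, j < k → 2 * (δ * (1 / 2) ^ j / 8) + 2 * (δ * (1 / 2) ^ k / 8) <
        dist ((δ * (1 / 2) ^ j) • e) ((δ * (1 / 2) ^ k) • e) := fun j k hjk => by
      have h1 : δ * (1 / 2) ^ k ≤ δ * (1 / 2) ^ j / 2 := by
        have : ((1 : ℝ) / 2) ^ k ≤ (1 / 2) ^ (j + 1) :=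
          pow_le_pow_of_le_one (by norm_num) (by norm_num) hjk
        rw [pow_succ] at this
        nlinarith
      have hj := hρ0 j
      rw [dist_eq_norm, ← sub_smul, norm_smul, he, mul_one]
      refine lt_of_lt_of_le ?_ (Real.le_norm_self _)
      linarith
    intro j k hjk
    rcases hjk.lt_or_gt with h | h
    · exact key j k h
    · rw [add_comm, dist_comm]
      exact key k j h

/-! ### The noncompactness theorem. -/

theorem mainTheorem5 (n m : ℕ) (hn : 2 ≤ n)
    (X : TopologicalSpace.Opens (EuclideanSpace ℝ (Fin n)))
    (hX : Convex ℝ (X : Set (EuclideanSpace ℝ (Fin n))))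
    (Y : Set (EuclideanSpace ℝ (Fin n))) (hYX : Y ⊆ X) (hY : Convex ℝ Y)
    (hYm : Module.finrank ℝ (vectorSpan ℝ Y) = m)
    (ψ : GrandWeight) (hb : ψ.b < n) (hAB : ψ.A₂ n m < ψ.B₂ n m) :
    ¬ IsCompactOperator (sobolevEmbedding X ψ (ψ.trace n m hb hAB) m Y) := by
  have hm : 0 < m := by exact_mod_cast ψ.cast_pos_of_A₂_lt_B₂ hAB
  have hne : Y.Nonempty := by
    by_contra h
    rw [not_nonempty_iff_eq_empty] at h
    rw [h, vectorSpan_empty, finrank_bot] at hYm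
    exact hm.ne hYm
  have : NeZero m := ⟨hm.ne'⟩
  set ν := ψ.trace n m hb hAB
  obtain ⟨f, hf, hYf, ε, hε, hfY⟩ := hY.exists_isometry_image_ball_subset hne hYm
  obtain ⟨z, r, hr0, hr1, hzr, hdist⟩ := exists_seq_disjoint_balls (E := EuclideanSpace ℝ (Fin m)) hε
  have hzY : ∀ k, f '' Metric.ball (z k) (r k) ⊆ Y := fun k => (image_mono (hzr k)).trans hfY
  obtain ⟨L, hL, hbump⟩ := exists_bump_fderiv_le (EuclideanSpace ℝ (Fin n))
  choose v hvC hv1 hvone hv0 hvd hvd0 using fun k => hbump (f (z k)) (r k) (hr0 k)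
  obtain ⟨D, hD, hscale⟩ := ψ.exists_scaleSup_le_trace hb hAB
  -- A bump may cross the boundary of `X`. Cutting it off there is harmless: smoothness is required
  -- only on the open set `X`, and the extension by zero is the convention for functions on `X`.
  set U : ℕ → EuclideanSpace ℝ (Fin n) → ℝ := fun k =>
    (X : Set (EuclideanSpace ℝ (Fin n))).indicator (v k) with hU
  set K := ENNReal.ofReal (L + 1) * max 1 (ENNReal.ofReal (2 ^ n) *
    volume (Metric.ball (0 : EuclideanSpace ℝ (Fin n)) 1))
  have hK : K ≠ ∞ := by
    refine ENNReal.mul_ne_top ENNReal.ofReal_ne_top (max_lt ENNReal.one_lt_top ?_).ne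
    exact ENNReal.mul_lt_top ENNReal.ofReal_lt_top measure_ball_lt_top
  set κ := min 1 (volume (Metric.ball (0 : EuclideanSpace ℝ (Fin m)) 1))
  have hκ0 : κ ≠ 0 := (lt_min one_pos (Metric.measure_ball_pos _ _ one_pos)).ne'
  have hκ : κ ≠ ∞ := ((min_le_left _ _).trans_lt ENNReal.one_lt_top).ne
  have htrace : ∀ k, ν.eNorm (U k) (surfaceMeasure m Y) < ∞ := fun k => by
    refine ν.eNorm_lt_top_of_forall_eLpNorm_le (max_lt ENNReal.one_lt_top
      (surfaceMeasure_closedBall_lt_top hf hYf (z k) (2 * r k))).ne fun q hq => ?_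
    have hq1 : 1 ≤ q := ν.one_le_a.trans hq.1.le
    refine (eLpNorm_le_of_norm_le_of_eq_zero (M := 1)
      (Metric.isClosed_closedBall (x := f (z k)) (ε := 2 * r k)).measurableSet (by linarith)
      (Eventually.of_forall fun x => (norm_indicator_le_norm_self _ _).trans (hv1 k x))
      (Eventually.of_forall fun x hx => ?_)).trans ?_
    · exact indicator_apply_eq_zero.2 fun _ => hv0 k x hx
    · rw [ENNReal.ofReal_one, one_mul]
      exact ENNReal.rpow_one_div_le_max_one _ hq1
  have hbound : ∀ k, sobolevENorm X ψ (U k) ≤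
      K * (D * κ⁻¹) * ν.eNorm (U k) (surfaceMeasure m Y) := fun k => by
    calc sobolevENorm X ψ (U k) ≤ K * ψ.scaleSup (fun p => n / p - 1) (r k) :=
          sobolevENorm_indicator_le X ψ (hr0 k) (hr1 k) hL (hv1 k) (hv0 k) (hvd k) (hvd0 k)
      _ ≤ K * (D * (κ⁻¹ * (κ * ν.scaleSup (fun q => m / q) (r k)))) := by
          rw [← mul_assoc κ⁻¹, ENNReal.inv_mul_cancel hκ0 hκ, one_mul]
          gcongr
          exact hscale (r k) (hr0 k) (hr1 k)
      _ ≤ K * (D * (κ⁻¹ * ν.eNorm (U k) (surfaceMeasure m Y))) := by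
          gcongr
          exact le_eNorm_surfaceMeasure_indicator hYX ν hf (hr0 k) (hzY k) (hvone k)
      _ = _ := by ring
  have hC : K * (D * κ⁻¹) ≠ ∞ :=
    ENNReal.mul_ne_top hK (ENNReal.mul_ne_top hD (ENNReal.inv_ne_top.2 hκ0))
  -- Finiteness of the `W₁(ψ)` norm is itself read off from the reversed inequality `hbound`, as the
  -- trace norm is finite.
  have hmem : ∀ k, U k ∈ sobolevGrandSubmodule X ψ := fun k =>
    ⟨(hvC k).contDiffOn.congr fun x hx => indicator_of_mem hx _,
      fun x hx => indicator_of_notMem hx _,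
      tendsto_const_nhds.congr' (by
        filter_upwards [Bornology.isBounded_def.1
          (Metric.isBounded_closedBall (x := f (z k)) (r := 2 * r k))] with x hx
        exact (indicator_apply_eq_zero.2 fun _ => hv0 k x hx).symm),
      (hbound k).trans_lt (ENNReal.mul_lt_top hC.lt_top (htrace k))⟩
  let W : ℕ → SobolevGrand X ψ := fun k => ⟨U k, hmem k⟩
  let u : ℕ → embeddingDomain X ψ ν m Y := fun k => ⟨W k, by
    change ν.eNorm (AEEqFun.mk (U k) (W k).measurable.aestronglyMeasurable :
      EuclideanSpace ℝ (Fin n) → ℝ) (surfaceMeasure m Y) < ∞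
    rw [ν.eNorm_congr (AEEqFun.coeFn_mk _ _)]
    exact htrace k⟩
  have hnorm : ∀ k, ‖u k‖ ≤ (K * (D * κ⁻¹)).toReal * ‖sobolevEmbedding X ψ ν m Y (u k)‖ :=
    fun k => by
      rw [norm_sobolevEmbedding, ← ENNReal.toReal_mul]
      exact ENNReal.toReal_mono (ENNReal.mul_lt_top hC.lt_top (htrace k)).ne (hbound k)
  refine not_isCompactOperator_of_birkhoff_orthogonal _ u _ (fun k h0 => ?_) hnorm
    fun j k hjk => norm_smul_sobolevEmbedding_le_of_disjoint _ _ fun x => ?_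
  -- A zero trace would force the bump to vanish by `hnorm`, but it equals 1 at its centre.
  · have h1 := hnorm k
    rw [h0, norm_zero, mul_zero, norm_le_zero_iff] at h1
    have h2 : U k (f (z k)) = 0 := congrArg (fun w => w.1.1 (f (z k))) h1
    have hx : f (z k) ∈ X := hYX (hzY k ⟨z k, Metric.mem_ball_self (hr0 k), rfl⟩)
    rw [hU] at h2
    simp only [indicator_of_mem (SetLike.mem_coe.2 hx)] at h2
    rw [hvone k _ (Metric.mem_closedBall_self (hr0 k).le)] at h2
    exact one_ne_zero h2
  -- The isometry `f` keeps the centres more than `2 r j + 2 r k` apart, so the supporting balls are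
  -- disjoint in `ℝⁿ` too.
  · by_cases hx : x ∈ Metric.closedBall (f (z j)) (2 * r j)
    · refine Or.inr (indicator_apply_eq_zero.2 fun _ => hv0 k x fun hx' => ?_)
      have h1 := hdist j k hjk
      rw [← hf.dist_eq] at h1
      exact h1.not_ge ((dist_triangle_left _ _ x).trans
        (add_le_add (Metric.mem_closedBall.1 hx) (Metric.mem_closedBall.1 hx')))
    · exact Or.inl (indicator_apply_eq_zero.2 fun _ => hv0 j x hx)
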